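/- **Definitions.** Let $\mathcal X$ be a finite data universe. An *online algorithm* $M$ consists of randomized internal algorithms $M_1,M_2,\dots$ and a randomized output algorithm $M_O$: on a stream $x=(x_1,\dots,x_n)$, $n\ge 1$, it computes the states $s_1=M_1(x_1)$, $s_i=M_i(x_i,s_{i-1})$ for $i\ge 2$, and publishes $M_O(s_n)$. The states and outputs live in arbitrary measurable spaces. For $\varepsilon>0$ and $\delta\in[0,1]$, $M$ is *$(\varepsilon,\delta)$-pan-private* (on streams of length $n$) if for all $x,x'\in\mathcal X^n$ that differ in at most one element, all $1\le t\le n$ and all measurable sets $T$ of (state, output) pairs, $$\Pr[(s_t(x),M_O(s_n(x)))\in T]\le e^{\varepsilon}\Pr[(s_t(x'),M_O(s_n(x')))\in T]+\delta .$$ Let $d\ge 2$ and $\alpha\in(0,1/2)$. An algorithm (which may depend on the set of hypotheses $\mathcal P$; for each $\mathcal P$ it is an online algorithm with outputs in $\mathcal P$) *solves $d$-wise simple hypothesis testing over $\mathcal X$ with error $\alpha$ and sample complexity $n$* if for every set $\mathcal P$ of $d$ distributions on $\mathcal X$ with $d_{TV}(\mathbf P,\mathbf P')\ge\alpha$ for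 all distinct $\mathbf P,\mathbf P'\in\mathcal P$, and every $\mathbf P\in\mathcal P$, given $n$ independent samples from $\mathbf P$ it outputs $\mathbf P$ with probability at least $99/100$. For $m\ge 1$, let $\mathbf U$ be the uniform distribution on $\{\pm1\}^m$, and for $j\in\{1,\dots,m\}$, $b\in\{\pm1\}$ let $\mathbf P_{j,b,\alpha}$ be the distribution on $\{\pm1\}^m$ with mass $(1+2\alpha)2^{-m}$ at $x$ if $x_j=b$ and $(1-2\alpha)2^{-m}$ if $x_j=-b$. **Theorem.** There are absolute constants $c_0,c>0$ such that for all $\alpha\in(0,1/2)$, $\varepsilon>0$, $\delta\in[0,1]$ and $n\ge1$ the following hold (with $\delta\log(d/\delta)=0$ for $\delta=0$). 1. Let $d\ge2$, let $m$ be such that $d\le 2m+1$, and suppose $\delta\log(d/\delta)\le c_0\,\alpha^2\varepsilon^2/d$. If $M$ is $(\varepsilon,\delta)$-pan-private (for every set of $d$ hypotheses on $\{\pm1\}^m$ that are pairwise $\alpha$-separated in total variation) and solves $d$-wise simple hypothesis testing over $\mathcal X=\{\pm1\}^m$ with error $\alpha$ and sample complexity $n$, then $$n\ \ge\ c\,\frac{\sqrt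 d}{\alpha\varepsilon}.$$ 2. (Hard instance.) Let $m\ge1$ and $d=2m+1$. The $d$ distributions $\{\mathbf U\}\cup\{\mathbf P_{j,b,\alpha}: 1\le j\le m,\ b\in\{\pm1\}\}$ are pairwise at total variation distance at least $\alpha$. If $\delta\log(d/\delta)\le c_0\,\alpha^2\varepsilon^2/d$, then every $(\varepsilon,\delta)$-pan-private online algorithm that, given $n$ independent samples from any one of these $d$ distributions, outputs that distribution with probability at least $99/100$ satisfies $n\ge c\sqrt d/(\alpha\varepsilon)$. -/

import Mathlib

open MeasureTheory ProbabilityTheory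

namespace PanPrivacy

/-- A randomized online algorithm with data universe `X` (discrete), internal states `S` and
outputs `O`. `first` is the first internal algorithm `M₁`, which maps the first data point to (the
law of) a state. For `i ≥ 2`, `step i` is the internal algorithm `M_i`, which maps the `i`-th data
point and the previous state to a new state (`step 0` and `step 1` are never used).
`out` is the output algorithm. -/
structure OnlineAlgorithm (X S O : Type*) [MeasurableSpace S] [MeasurableSpace O] where
  first : X → Measure S
  step : ℕ → X → Kernel S S
  out : Kernel S O
  isProbabilityMeasure_first : ∀ x, IsProbabilityMeasure (first x)
  isMarkovKernel_step : ∀ i x, IsMarkovKernel (step i x)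
  isMarkovKernel_out : IsMarkovKernel out

attribute [instance] OnlineAlgorithm.isProbabilityMeasure_first
  OnlineAlgorithm.isMarkovKernel_step OnlineAlgorithm.isMarkovKernel_out

namespace OnlineAlgorithm

variable {X S O : Type*} [MeasurableSpace S] [MeasurableSpace O]

/-- Started in the state after `t` data points, process the data points in the list with
`M_{t+1}, M_{t+2}, …`. -/
noncomputable def runFrom (M : OnlineAlgorithm X S O) : ℕ → List X → Kernel S S
  | _, [] => Kernel.id
  | t, x :: l => M.runFrom (t + 1) l ∘ₖ M.step (t + 1) x

/-- Law of the internal state after a nonempty stream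
(on the empty stream there is no state; junk value `0`). -/
noncomputable def stateLaw (M : OnlineAlgorithm X S O) : List X → Measure S
  | [] => 0
  | x :: l => (M.first x).bind (M.runFrom 1 l)

/-- Law of the final output on a stream. -/
noncomputable def outputLaw (M : OnlineAlgorithm X S O) (x : List X) : Measure O :=
  (M.stateLaw x).bind M.out

/-- Joint law of the internal state after the first `t` elements of the stream and of the final
output on the whole stream. -/
noncomputable def view (M : OnlineAlgorithm X S O) (t : ℕ) (x : List X) : Measure (S × O) :=
  M.stateLaw (x.take t) ⊗ₘ (M.out ∘ₖ M.runFrom t (x.drop t))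

instance isMarkovKernel_runFrom (M : OnlineAlgorithm X S O) (t : ℕ) (l : List X) :
    IsMarkovKernel (M.runFrom t l) := by
  induction l generalizing t with
  | nil => unfold runFrom; infer_instance
  | cons x l ih => have := ih (t + 1); unfold runFrom; infer_instance

theorem isProbabilityMeasure_stateLaw (M : OnlineAlgorithm X S O) {l : List X} (hl : l ≠ []) :
    IsProbabilityMeasure (M.stateLaw l) := by
  cases l with
  | nil => exact absurd rfl hl
  | cons x l => unfold stateLaw; infer_instance

/-- `(ε, δ)`-pan-privacy on streams of length `n`: for all streams `x`, `x'` that differ in at most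
one element and every time `t`, the joint law of (state at time `t`, final output) is
`(ε, δ)`-indistinguishable. -/
def PanPrivate [DecidableEq X] (M : OnlineAlgorithm X S O) (n : ℕ) (ε δ : ℝ) : Prop :=
  ∀ x x' : Fin n → X, hammingDist x x' ≤ 1 → ∀ t : ℕ, 1 ≤ t → t ≤ n →
    ∀ T : Set (S × O), MeasurableSet T →
      M.view t (List.ofFn x) T
        ≤ ENNReal.ofReal (Real.exp ε) * M.view t (List.ofFn x') T + ENNReal.ofReal δ

/-- The probability that the final output of `M` is `o` when the stream consists of `n` independent
samples from the distribution with probability mass function `p`. -/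
noncomputable def outputProb [Fintype X] (M : OnlineAlgorithm X S O) (n : ℕ) (p : stdSimplex ℝ X)
    (o : O) : ℝ :=
  ∑ x : Fin n → X, (∏ k, p.1 (x k)) * (M.outputLaw (List.ofFn x)).real {o}

/-- Given `n` independent samples from any member of the family `P` (labelled by `ι`),
`M` outputs (the label of) that member with probability at least `99/100`. -/
def Identifies {ι : Type*} [MeasurableSpace ι] [Fintype X] (M : OnlineAlgorithm X S ι) (n : ℕ)
    (P : ι → stdSimplex ℝ X) : Prop :=
  ∀ i, 99 / 100 ≤ M.outputProb n (P i) i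

end OnlineAlgorithm

/-- Total variation distance of two distributions on a finite set, given by their probability mass
functions. -/
noncomputable def dTV {X : Type*} [Fintype X] (p q : stdSimplex ℝ X) : ℝ :=
  (1 / 2) * ∑ x, |p.1 x - q.1 x|

/-- The members of the family are pairwise at total variation distance at least `α`. -/
def IsSeparated {X ι : Type*} [Fintype X] (α : ℝ) (P : ι → stdSimplex ℝ X) : Prop :=
  Pairwise fun i j => α ≤ dTV (P i) (P j)

/-- `M` solves `d`-wise simple hypothesis testing over the data universe `X` with error `α` and
sample complexity `n`. The set of hypotheses is known to the algorithm: `M P` is the algorithm used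
for the set `P` (enumerated by `Fin d`). -/
def SolvesHypothesisTesting {X S : Type*} [Fintype X] [MeasurableSpace S] (d n : ℕ) (α : ℝ)
    (M : (Fin d → stdSimplex ℝ X) → OnlineAlgorithm X S (Fin d)) : Prop :=
  ∀ P, IsSeparated α P → (M P).Identifies n P

/-- The cube `{±1}^m`. -/
abbrev Cube (m : ℕ) : Type := Fin m → ℤˣ

/-- The uniform distribution on `{±1}^m`. -/
noncomputable def uniformDist (m : ℕ) : stdSimplex ℝ (Cube m) :=
  ⟨fun _ => (2 ^ m)⁻¹, fun _ => by positivity, by simp⟩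

/-- The pmf of the distribution on `{±1}^m` biased towards `x j = b`. -/
noncomputable def biasedPMF (m : ℕ) (α : ℝ) (j : Fin m) (b : ℤˣ) (x : Cube m) : ℝ :=
  if x j = b then (1 + 2 * α) * (2 ^ m)⁻¹ else (1 - 2 * α) * (2 ^ m)⁻¹

theorem sum_biasedPMF (m : ℕ) (α : ℝ) (j : Fin m) (b : ℤˣ) :
    ∑ x, biasedPMF m α j b x = 1 := by
  let e : Cube m ≃ Cube m :=
    Function.Involutive.toPerm (fun x => Function.update x j (-(x j))) (fun x => by simp)
  have hx : ∀ x : Cube m, biasedPMF m α j b x + biasedPMF m α j b (e x) = 2 * (2 ^ m)⁻¹ := by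
    intro x
    have he : e x j = -(x j) := by simp [e, Function.Involutive.toPerm]
    unfold biasedPMF
    rw [he]
    rcases Int.units_eq_one_or (x j) with h | h <;> rcases Int.units_eq_one_or b with h' | h' <;>
      simp [h, h'] <;> ring
  have h2 : ∑ x, biasedPMF m α j b x + ∑ x, biasedPMF m α j b (e x) = 2 := by
    rw [← Finset.sum_add_distrib, Finset.sum_congr rfl fun x _ => hx x]
    simp
    field_simp
  rw [Equiv.sum_comp e (biasedPMF m α j b)] at h2
  linarith

/-- The 1-sparse biased distribution on `{±1}^m`, for `0 < α < 1/2`. -/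
noncomputable def biasedDist (m : ℕ) (α : ℝ) (hα : α ∈ Set.Ioo (0 : ℝ) (1 / 2)) (j : Fin m)
    (b : ℤˣ) : stdSimplex ℝ (Cube m) :=
  ⟨biasedPMF m α j b, fun x => by
    have h1 : 0 ≤ 1 + 2 * α := by linarith [hα.1]
    have h2 : 0 ≤ 1 - 2 * α := by linarith [hα.2]
    unfold biasedPMF
    split_ifs <;> positivity, sum_biasedPMF m α j b⟩

/-- Labels of the `2m + 1` hypotheses of the hard instance. -/
inductive HardLabel (m : ℕ) : Type
  | uniform : HardLabel m
  | biased (j : Fin m) (b : ℤˣ) : HardLabel m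

instance (m : ℕ) : MeasurableSpace (HardLabel m) := ⊤

/-- The hard instance: the uniform distribution together with the 1-sparse biased family. -/
noncomputable def hardFamily (m : ℕ) (α : ℝ) (hα : α ∈ Set.Ioo (0 : ℝ) (1 / 2)) :
    HardLabel m → stdSimplex ℝ (Cube m)
  | .uniform => uniformDist m
  | .biased j b => biasedDist m α hα j b

end PanPrivacy

/-! Fix `k` distinct coordinates `c j` and compare uniform samples with samples biased towards `x (c
j) = 1`. An algorithm that identifies the hypotheses names each biased law with probability at least
0.99 when it is the true one, while under the uniform law these `k` disjoint outcomes have total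
probability at most 0.01. So the gains in probability, summed over `j`, are at least `0.98 k`. The
theorem follows from an upper bound of order `n α ε √k` on this sum.

The gain telescopes over hybrids whose first `i` samples are uniform and whose other samples are
biased. Neighbouring hybrids share a uniform prefix `w` and differ in the law of one sample `x`,
where the densities differ by `2α 2⁻ᵐ x (c j)`. The law `μ x` of the state after `w, x` does not
depend on `j`. Hence the summed gain is `2α` times the mean of `∑ j, x (c j) φ j s`, with `x`
uniform and `s` drawn from `μ x`, where `φ j s ∈ [0, 1]` is the chance that a biased suffix leads
from `s` to the label of `j`. A single state would have to be correlated with `k` random signs at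
once. For `s` independent of `x` this sum has mean zero and is subgaussian at scale `√k`;
pan-privacy makes the laws `μ x` mutually indistinguishable, which leaves a mean of at most `8ε√k +
2δk` (`sum_integral_signSum_le`).

`sum_listExp_sub_le` treats one hybrid step, `sum_outputProb_sub_le` telescopes, and
`sampleComplexity_lower_bound` compares with `0.98 k`. The condition on `δ` enters only through `δ ≤
ε / √d`. -/

namespace PanPrivacy

/-! ### Indistinguishability for bounded functions -/

section Indistinguishable

variable {S : Type*} [MeasurableSpace S]

theorem integrable_of_measurable_of_abs_le {μ : Measure S} [IsFiniteMeasure μ] {h : S → ℝ} {B : ℝ}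
    (hm : Measurable h) (hB : ∀ s, |h s| ≤ B) : Integrable h μ :=
  Integrable.of_bound hm.aestronglyMeasurable B (Filter.Eventually.of_forall hB)

/-- Indistinguishability of events implies indistinguishability of bounded nonnegative
functions. -/
theorem integral_le_of_indistinguishable {μ ν : Measure S} [IsProbabilityMeasure μ]
    [IsProbabilityMeasure ν] {ε δ B : ℝ} (hδ : 0 ≤ δ) (hB : 0 ≤ B)
    (h : ∀ A, MeasurableSet A →
      μ A ≤ ENNReal.ofReal (Real.exp ε) * ν A + ENNReal.ofReal δ)
    {f : S → ℝ} (hf : Measurable f) (hf0 : ∀ s, 0 ≤ f s) (hfB : ∀ s, f s ≤ B) :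
    ∫ s, f s ∂μ ≤ Real.exp ε * ∫ s, f s ∂ν + δ * B := by
  have habs : ∀ s, |f s| ≤ B := fun s => by rw [abs_of_nonneg (hf0 s)]; exact hfB s
  have hreal : ∀ A, MeasurableSet A → μ.real A ≤ Real.exp ε * ν.real A + δ := by
    intro A hA
    have h1 := ENNReal.toReal_mono (by finiteness) (h A hA)
    rw [ENNReal.toReal_add (by finiteness) (by finiteness), ENNReal.toReal_mul,
      ENNReal.toReal_ofReal (Real.exp_pos _).le, ENNReal.toReal_ofReal hδ] at h1
    exact h1
  have hint : ∀ (ρ : Measure S) [IsProbabilityMeasure ρ],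
      IntegrableOn (fun t => ρ.real {a | t ≤ f a}) (Set.Ioc 0 B) := by
    intro ρ _
    have hanti : Antitone fun t => ρ.real {a | t ≤ f a} :=
      fun t u htu => measureReal_mono fun a (ha : u ≤ f a) => htu.trans ha
    exact ((hanti.antitoneOn _).integrableOn_isCompact (isCompact_Icc (a := 0) (b := B))).mono_set
      Set.Ioc_subset_Icc_self
  -- Layer cake over thresholds in `(0, B]`: each superlevel set costs one `δ`, which integrates to
  -- `δ * B`.
  rw [(integrable_of_measurable_of_abs_le hf habs).integral_eq_integral_Ioc_meas_le
      (Filter.Eventually.of_forall hf0) (Filter.Eventually.of_forall hfB),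
    (integrable_of_measurable_of_abs_le hf habs).integral_eq_integral_Ioc_meas_le
      (Filter.Eventually.of_forall hf0) (Filter.Eventually.of_forall hfB)]
  calc ∫ t in Set.Ioc 0 B, μ.real {a | t ≤ f a}
      ≤ ∫ t in Set.Ioc 0 B, (Real.exp ε * ν.real {a | t ≤ f a} + δ) := by
        refine integral_mono (hint μ) (((hint ν).const_mul _).add (integrable_const _)) fun t => ?_
        exact hreal _ (measurableSet_le measurable_const hf)
    _ = _ := by
        rw [integral_add ((hint ν).const_mul _) (integrable_const _), integral_const_mul]
        simp [hB, mul_comm]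

end Indistinguishable

/-! ### Correlation of a private state with random signs -/

section Cube

variable {m k : ℕ}

theorem abs_units_cast (u : ℤˣ) : |((u : ℤ) : ℝ)| = 1 := by
  rcases Int.units_eq_one_or u with h | h <;> simp [h]

theorem sum_units_real (f : ℤˣ → ℝ) : ∑ u, f u = f 1 + f (-1) := by
  rw [show (Finset.univ : Finset ℤˣ) = {1, -1} from rfl, Finset.sum_pair (by decide)]

/-- The average over the cube of a function of independent signs. -/
theorem sum_exp_signs_le (a : Fin m → ℝ) :
    (2 ^ m : ℝ)⁻¹ * ∑ x : Cube m, Real.exp (∑ j, ((x j : ℤ) : ℝ) * a j)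
      ≤ Real.exp ((∑ j, a j ^ 2) / 2) := by
  have h1 : ∑ x : Cube m, Real.exp (∑ j, ((x j : ℤ) : ℝ) * a j)
      = ∏ j, ∑ u : ℤˣ, Real.exp (((u : ℤ) : ℝ) * a j) := by
    rw [Finset.prod_univ_sum, Fintype.piFinset_univ]
    simp only [Real.exp_sum]
  have h2 : (2 ^ m : ℝ)⁻¹ = ∏ _j : Fin m, (2 : ℝ)⁻¹ := by simp
  rw [h1, h2, ← Finset.prod_mul_distrib, Finset.sum_div, Real.exp_sum]
  refine Finset.prod_le_prod (fun j _ => ?_) fun j _ => ?_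
  · positivity
  · rw [sum_units_real]
    refine le_trans (le_of_eq ?_) (Real.cosh_le_exp_half_sq (a j))
    rw [Real.cosh_eq]
    simp
    ring

theorem sum_sign_eq_zero (j : Fin m) : ∑ x : Cube m, ((x j : ℤ) : ℝ) = 0 := by
  have h := Equiv.sum_comp (Equiv.neg (Cube m)) fun x => ((x j : ℤ) : ℝ)
  simp at h
  linarith

variable (c : Fin k → Fin m)

/-- The linear form in the signs at the coordinates `c j`, with weights `a j`. -/
noncomputable def signSum (a : Fin k → ℝ) (x : Cube m) : ℝ := ∑ j, ((x (c j) : ℤ) : ℝ) * a j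

theorem abs_signSum_le {a : Fin k → ℝ} (ha : ∀ j, |a j| ≤ 1) (x : Cube m) :
    |signSum c a x| ≤ k := by
  calc |signSum c a x| ≤ ∑ j, |((x (c j) : ℤ) : ℝ) * a j| := Finset.abs_sum_le_sum_abs _ _
    _ ≤ ∑ _j : Fin k, (1 : ℝ) := Finset.sum_le_sum fun j _ => by
        rw [abs_mul, abs_units_cast, one_mul]; exact ha j
    _ = k := by simp

theorem sum_signSum (a : Fin k → ℝ) : ∑ x, signSum c a x = 0 := by
  unfold signSum
  rw [Finset.sum_comm]
  refine Finset.sum_eq_zero fun j _ => ?_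
  rw [← Finset.sum_mul, sum_sign_eq_zero, zero_mul]

variable {c}

/-- Division by `√k` makes the squared weights sum to at most 1, so the subgaussian bound gives
`e^{1/2} ≤ 2`. -/
theorem sum_exp_signSum_le (hc : Function.Injective c) (hk : 1 ≤ k) {a : Fin k → ℝ}
    (ha : ∀ j, |a j| ≤ 1) {r : ℝ} (hr : r ^ 2 = 1) :
    (2 ^ m : ℝ)⁻¹ * ∑ x : Cube m, Real.exp (r * signSum c a x / √k) ≤ 2 := by
  have hk0 : (0 : ℝ) < k := by exact_mod_cast hk
  -- The weights carried over to all `m` coordinates; as `c` is injective, each coordinate receives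
  -- at most one.
  let b : Fin m → ℝ := fun i => ∑ j, if c j = i then r * a j / √k else 0
  have hb : ∀ j, b (c j) = r * a j / √k := by
    intro j
    simp only [b]
    rw [Finset.sum_eq_single j]
    · simp
    · intro j' _ hj'
      simp [hc.ne hj']
    · simp
  have hb0 : ∀ i, i ∉ Set.range c → b i = 0 := by
    intro i hi
    refine Finset.sum_eq_zero fun j _ => ?_
    rw [if_neg fun h => hi ⟨j, h⟩]
  have hsum : ∀ g : Fin m → ℝ, (∀ i, i ∉ Set.range c → g i = 0) → ∑ i, g i = ∑ j, g (c j) := by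
    intro g hg
    exact (Fintype.sum_of_injective c hc _ g hg fun _ => rfl).symm
  have h1 : ∀ x : Cube m, r * signSum c a x / √k = ∑ i, ((x i : ℤ) : ℝ) * b i := by
    intro x
    rw [hsum _ fun i hi => by rw [hb0 i hi, mul_zero], signSum, Finset.mul_sum, Finset.sum_div]
    refine Finset.sum_congr rfl fun j _ => ?_
    rw [hb]
    ring
  have h2 : ∑ i, b i ^ 2 ≤ 1 := by
    rw [hsum _ fun i hi => by rw [hb0 i hi]; simp]
    calc ∑ j, b (c j) ^ 2 ≤ ∑ _j : Fin k, (1 / k : ℝ) := Finset.sum_le_sum fun j _ => by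
          rw [hb, div_pow, mul_pow, hr, Real.sq_sqrt hk0.le, one_mul]
          gcongr
          exact (sq_le_one_iff_abs_le_one _).2 (ha j)
      _ = 1 := by simp; field_simp
  simp_rw [h1]
  refine (sum_exp_signs_le b).trans ?_
  have h3 : Real.exp ((∑ i, b i ^ 2) / 2) ^ 2 ≤ 2 ^ 2 := by
    rw [← Real.exp_nat_mul]
    calc Real.exp _ ≤ Real.exp 1 := Real.exp_le_exp.2 (by push_cast; linarith)
      _ ≤ 2 ^ 2 := by linarith [Real.exp_one_lt_d9]
  exact le_of_sq_le_sq h3 (by norm_num)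

variable {S : Type*} [MeasurableSpace S]

theorem measurable_signSum {φ : Fin k → S → ℝ} (hφ : ∀ j, Measurable (φ j)) (x : Cube m) :
    Measurable fun s => signSum c (fun j => φ j s) x := by
  unfold signSum
  fun_prop

theorem integral_sum_exp_signSum_le (hc : Function.Injective c) (hk : 1 ≤ k) {φ : Fin k → S → ℝ}
    (hφ : ∀ j, Measurable (φ j)) (ha : ∀ j s, |φ j s| ≤ 1) {r : ℝ} (hr : r ^ 2 = 1)
    (ν : Measure S) [IsProbabilityMeasure ν] :
    (2 ^ m : ℝ)⁻¹ * ∑ x : Cube m, ∫ s, Real.exp (r * signSum c (fun j => φ j s) x / √k) ∂ν ≤ 2 := by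
  have hm := fun x => measurable_signSum (c := c) hφ x
  have hr1 : |r| = 1 := by
    rw [← sq_abs] at hr
    nlinarith [abs_nonneg r]
  have hint : ∀ x : Cube m,
      Integrable (fun s => Real.exp (r * signSum c (fun j => φ j s) x / √k)) ν := by
    intro x
    refine integrable_of_measurable_of_abs_le (B := Real.exp (k / √k)) ?_ fun s => ?_
    · exact (((hm x).const_mul r).div_const _).exp
    · rw [abs_of_pos (Real.exp_pos _)]
      gcongr
      refine (le_abs_self _).trans ?_
      rw [abs_mul, hr1, one_mul]
      exact abs_signSum_le c (fun j => ha j s) x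
  rw [← integral_finsetSum _ fun x _ => hint x, ← integral_const_mul]
  calc _ ≤ ∫ _s, (2 : ℝ) ∂ν := by
        refine integral_mono ((integrable_finsetSum _ fun x _ => hint x).const_mul _)
          (integrable_const _) fun s => ?_
        exact sum_exp_signSum_le hc hk (fun j => ha j s) hr
    _ = 2 := by simp

/-- If the laws `μ x` are pairwise indistinguishable, then a state drawn from `μ x` is on average
nearly uncorrelated with the signs of `x`. -/
theorem sum_integral_signSum_le (hc : Function.Injective c) (hk : 1 ≤ k) {φ : Fin k → S → ℝ}
    (hφ : ∀ j, Measurable (φ j)) (ha : ∀ j s, |φ j s| ≤ 1) (μ : Cube m → Measure S)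
    [∀ x, IsProbabilityMeasure (μ x)] {ε δ : ℝ} (hε : 0 < ε) (hδ : 0 ≤ δ)
    (h : ∀ x y A, MeasurableSet A →
      μ x A ≤ ENNReal.ofReal (Real.exp ε) * μ y A + ENNReal.ofReal δ) :
    (2 ^ m : ℝ)⁻¹ * ∑ x : Cube m, ∫ s, signSum c (fun j => φ j s) x ∂(μ x)
      ≤ 8 * ε * √k + 2 * δ * k := by
  have hk0 : (0 : ℝ) < k := by exact_mod_cast hk
  have hsk : 0 < √(k : ℝ) := Real.sqrt_pos.2 hk0
  have hcard : (2 ^ m : ℝ)⁻¹ * ∑ _x : Cube m, (1 : ℝ) = 1 := by simp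
  -- A reference law independent of `x`; the choice of the point `1` is arbitrary.
  let ν := μ 1
  let W : Cube m → S → ℝ := fun x s => signSum c (fun j => φ j s) x
  have hWm : ∀ x, Measurable (W x) := fun x => measurable_signSum hφ x
  have hWk : ∀ x s, |W x s| ≤ k := fun x s => abs_signSum_le c (fun j => ha j s) x
  have hWint : ∀ x (ρ : Measure S) [IsProbabilityMeasure ρ], Integrable (W x) ρ :=
    fun x ρ _ => integrable_of_measurable_of_abs_le (hWm x) (hWk x)
  have hexpint : ∀ (r : ℝ) x, Integrable (fun s => Real.exp (r * W x s / √k)) ν := by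
    intro r x
    refine integrable_of_measurable_of_abs_le (B := Real.exp (|r| * k / √k)) ?_ fun s => ?_
    · exact (((hWm x).const_mul r).div_const _).exp
    · rw [abs_of_pos (Real.exp_pos _)]
      refine Real.exp_le_exp.2 (div_le_div_of_nonneg_right ((le_abs_self _).trans ?_) hsk.le)
      rw [abs_mul]
      exact mul_le_mul_of_nonneg_left (hWk x s) (abs_nonneg r)
  have hE1 := integral_sum_exp_signSum_le hc hk hφ ha (r := 1) (by norm_num) ν
  have hE2 := integral_sum_exp_signSum_le hc hk hφ ha (r := -1) (by norm_num) ν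
  change (2 ^ m : ℝ)⁻¹ * ∑ x : Cube m, ∫ s, Real.exp (1 * W x s / √k) ∂ν ≤ 2 at hE1
  change (2 ^ m : ℝ)⁻¹ * ∑ x : Cube m, ∫ s, Real.exp (-1 * W x s / √k) ∂ν ≤ 2 at hE2
  change (2 ^ m : ℝ)⁻¹ * ∑ x : Cube m, ∫ s, W x s ∂(μ x) ≤ _
  -- For `ε ≥ 1`, cut `W` at height `√k ε`. The part below costs `ε√k`; for the tail, `t ≤ e^t`
  -- gives `e^ε (W - √k ε)⁺ ≤ √k e^{W/√k}`, so the factor `e^ε` is absorbed and the average is at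
  -- most `2√k`.
  rcases le_total 1 ε with h1 | h1
  · have hx : ∀ x, ∫ s, W x s ∂(μ x)
        ≤ (√k * ε + δ * k) * 1 + √k * ∫ s, Real.exp (1 * W x s / √k) ∂ν := by
      intro x
      have hpm : Measurable fun s => max (W x s - √k * ε) 0 :=
        ((hWm x).sub_const _).max measurable_const
      have hpB : ∀ s, max (W x s - √k * ε) 0 ≤ k := fun s =>
        max_le (by nlinarith [(abs_le.1 (hWk x s)).2]) hk0.le
      have hpint : ∀ (ρ : Measure S) [IsProbabilityMeasure ρ],
          Integrable (fun s => max (W x s - √k * ε) 0) ρ := fun ρ _ =>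
        integrable_of_measurable_of_abs_le hpm fun s => by
          rw [abs_of_nonneg (le_max_right _ _)]; exact hpB s
      have e1 : ∫ s, W x s ∂(μ x) ≤ √k * ε + ∫ s, max (W x s - √k * ε) 0 ∂(μ x) := by
        calc ∫ s, W x s ∂(μ x) ≤ ∫ s, (√k * ε + max (W x s - √k * ε) 0) ∂(μ x) :=
              integral_mono (hWint x _) ((integrable_const _).add (hpint _)) fun s => by
                have := le_max_left (W x s - √k * ε) 0
                dsimp only
                linarith
          _ = _ := by rw [integral_add (integrable_const _) (hpint _)]; simp
      have e2 := integral_le_of_indistinguishable hδ hk0.le (h x 1) hpm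
        (fun s => le_max_right _ _) hpB
      have e3 : Real.exp ε * ∫ s, max (W x s - √k * ε) 0 ∂ν
          ≤ √k * ∫ s, Real.exp (1 * W x s / √k) ∂ν := by
        rw [← integral_const_mul, ← integral_const_mul]
        refine integral_mono ((hpint _).const_mul _) ((hexpint _ _).const_mul _) fun s => ?_
        have e4 : max (W x s - √k * ε) 0 ≤ √k * Real.exp (1 * W x s / √k - ε) := by
          refine max_le ?_ (by positivity)
          calc W x s - √k * ε = √k * (1 * W x s / √k - ε) := by field_simp
            _ ≤ _ := by
              gcongr
              linarith [Real.add_one_le_exp (1 * W x s / √k - ε)]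
        calc Real.exp ε * max (W x s - √k * ε) 0
            ≤ Real.exp ε * (√k * Real.exp (1 * W x s / √k - ε)) := by gcongr
          _ = √k * Real.exp (1 * W x s / √k) := by rw [Real.exp_sub]; field_simp
      linarith
    calc _ ≤ (2 ^ m : ℝ)⁻¹ * ∑ x : Cube m,
          ((√k * ε + δ * k) * 1 + √k * ∫ s, Real.exp (1 * W x s / √k) ∂ν) := by
          gcongr with x
          exact hx x
      _ = (√k * ε + δ * k) * ((2 ^ m : ℝ)⁻¹ * ∑ _x : Cube m, (1 : ℝ))
          + √k * ((2 ^ m : ℝ)⁻¹ * ∑ x : Cube m, ∫ s, Real.exp (1 * W x s / √k) ∂ν) := by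
          rw [Finset.sum_add_distrib, ← Finset.mul_sum, ← Finset.mul_sum]; ring
      _ ≤ (√k * ε + δ * k) * 1 + √k * 2 := by rw [hcard]; gcongr
      _ ≤ _ := by nlinarith [mul_nonneg hδ hk0.le]
  -- For `ε ≤ 1`, compare with the mean under `ν`, which averages to zero over `x`. The positive
  -- part is bounded above by passing from `μ x` to `ν`, the negative part below by the reverse
  -- passage. Each costs a multiple of `ε` times its mean under `ν`, which is of order `√k` on
  -- average.
  · have hx : ∀ x, ∫ s, W x s ∂(μ x) ≤ ∫ s, W x s ∂ν + 2 * ε * √k *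
          (∫ s, Real.exp (1 * W x s / √k) ∂ν + ∫ s, Real.exp (-1 * W x s / √k) ∂ν)
          + 2 * δ * k * 1 := by
      intro x
      have hpm : ∀ r : ℝ, Measurable fun s => max (r * W x s) 0 := fun r =>
        ((hWm x).const_mul _).max measurable_const
      have hpB : ∀ r : ℝ, |r| = 1 → ∀ s, max (r * W x s) 0 ≤ k := fun r hr s =>
        max_le ((le_abs_self _).trans (by rw [abs_mul, hr, one_mul]; exact hWk x s)) hk0.le
      have hpint : ∀ r : ℝ, |r| = 1 → ∀ (ρ : Measure S) [IsProbabilityMeasure ρ],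
          Integrable (fun s => max (r * W x s) 0) ρ := fun r hr ρ _ =>
        integrable_of_measurable_of_abs_le (hpm r) fun s => by
          rw [abs_of_nonneg (le_max_right _ _)]; exact hpB r hr s
      have hsplit : ∀ (ρ : Measure S) [IsProbabilityMeasure ρ],
          ∫ s, W x s ∂ρ = ∫ s, max (1 * W x s) 0 ∂ρ - ∫ s, max (-1 * W x s) 0 ∂ρ := by
        intro ρ _
        rw [← integral_sub (hpint 1 (by simp) ρ) (hpint (-1) (by simp) ρ)]
        congr 1
        ext s
        rcases le_total 0 (W x s) with h0 | h0
        · rw [max_eq_left (by linarith), max_eq_right (by linarith)]; ring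
        · rw [max_eq_right (by linarith), max_eq_left (by linarith)]; ring
      have hbound : ∀ r : ℝ, |r| = 1 →
          ∫ s, max (r * W x s) 0 ∂ν ≤ √k * ∫ s, Real.exp (r * W x s / √k) ∂ν := by
        intro r hr
        rw [← integral_const_mul]
        refine integral_mono (hpint r hr _) ((hexpint _ _).const_mul _) fun s => ?_
        refine max_le ?_ (by positivity)
        calc r * W x s = √k * (r * W x s / √k) := by field_simp
          _ ≤ _ := by
            gcongr
            linarith [Real.add_one_le_exp (r * W x s / √k)]
      have e1 := integral_le_of_indistinguishable hδ hk0.le (h x 1) (hpm 1)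
        (fun s => le_max_right _ _) (hpB 1 (by simp))
      have e2 := integral_le_of_indistinguishable hδ hk0.le (h 1 x) (hpm (-1))
        (fun s => le_max_right _ _) (hpB (-1) (by simp))
      have b1 := hbound 1 (by simp)
      have b2 := hbound (-1) (by simp)
      have n1 : 0 ≤ ∫ s, max (1 * W x s) 0 ∂ν := integral_nonneg fun s => le_max_right _ _
      have n2 : 0 ≤ ∫ s, max (-1 * W x s) 0 ∂ν := integral_nonneg fun s => le_max_right _ _
      rw [hsplit, hsplit ν]
      change ∫ s, max (-1 * W x s) 0 ∂ν ≤ Real.exp ε * ∫ s, max (-1 * W x s) 0 ∂(μ x) + _ at e2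
      change _ ≤ Real.exp ε * ∫ s, max (1 * W x s) 0 ∂ν + _ at e1
      generalize ∫ s, max (1 * W x s) 0 ∂ν = a at *
      generalize ∫ s, max (-1 * W x s) 0 ∂ν = b at *
      generalize ∫ s, max (-1 * W x s) 0 ∂(μ x) = b' at *
      have hexp : Real.exp ε ≤ 1 + 2 * ε := by
        have := Real.abs_exp_sub_one_le (x := ε) (by rw [abs_of_pos hε]; exact h1)
        rw [abs_of_pos hε] at this
        linarith [(abs_le.1 this).2]
      have hexp' : 1 - ε ≤ Real.exp (-ε) := by linarith [Real.add_one_le_exp (-ε)]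
      have hb' : b - ε * b - δ * k ≤ b' := by
        have e5 : Real.exp (-ε) * (b - δ * k) ≤ b' := by
          calc _ ≤ Real.exp (-ε) * (Real.exp ε * b') := by gcongr; linarith
            _ = b' := by rw [← mul_assoc, ← Real.exp_add]; simp
        have e6 : Real.exp (-ε) ≤ 1 := Real.exp_le_one_iff.2 (by linarith)
        nlinarith [mul_nonneg hδ hk0.le]
      have ha' : Real.exp ε * a ≤ a + 2 * ε * a := by nlinarith
      nlinarith
    calc _ ≤ (2 ^ m : ℝ)⁻¹ * ∑ x : Cube m, (∫ s, W x s ∂ν + 2 * ε * √k *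
          (∫ s, Real.exp (1 * W x s / √k) ∂ν + ∫ s, Real.exp (-1 * W x s / √k) ∂ν)
          + 2 * δ * k * 1) := by
          gcongr with x
          exact hx x
      _ = (2 ^ m : ℝ)⁻¹ * ∑ x : Cube m, ∫ s, W x s ∂ν
          + 2 * ε * √k * ((2 ^ m : ℝ)⁻¹ * ∑ x : Cube m, ∫ s, Real.exp (1 * W x s / √k) ∂ν
            + (2 ^ m : ℝ)⁻¹ * ∑ x : Cube m, ∫ s, Real.exp (-1 * W x s / √k) ∂ν)
          + 2 * δ * k * ((2 ^ m : ℝ)⁻¹ * ∑ _x : Cube m, (1 : ℝ)) := by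
          rw [Finset.sum_add_distrib, Finset.sum_add_distrib, ← Finset.mul_sum, ← Finset.mul_sum,
            Finset.sum_add_distrib]
          ring
      _ ≤ 0 + 2 * ε * √k * (2 + 2) + 2 * δ * k * 1 := by
          have hzero : ∑ x : Cube m, ∫ s, W x s ∂ν = 0 := by
            rw [← integral_finsetSum _ fun x _ => hWint x ν]
            simp [W, sum_signSum]
          rw [hcard, hzero, mul_zero]
          gcongr
      _ = _ := by ring

end Cube


/-! ### Expectations over independent samples -/

section ListExp

variable {X : Type*} [Fintype X]

/-- Expectation of `f` on a list of `r` independent samples with probability mass function `p`. -/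
noncomputable def listExp (p : X → ℝ) : ℕ → (List X → ℝ) → ℝ
  | 0, f => f []
  | r + 1, f => ∑ x, p x * listExp p r fun l => f (x :: l)

/-- Trades the sum over `Fin n → X` for a recursion that peels samples off the front, in step with
`runFrom`, so that a stream can be cut at any time. -/
theorem sum_prod_ofFn_eq_listExp (p : X → ℝ) (n : ℕ) (f : List X → ℝ) :
    ∑ x : Fin n → X, (∏ k, p (x k)) * f (List.ofFn x) = listExp p n f := by
  induction n generalizing f with
  | zero => simp [listExp]
  | succ n ih =>
    rw [← (Fin.consEquiv fun _ : Fin (n + 1) => X).sum_comp, Fintype.sum_prod_type, listExp]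
    refine Finset.sum_congr rfl fun x _ => ?_
    rw [← ih, Finset.mul_sum]
    refine Finset.sum_congr rfl fun y _ => ?_
    simp [Fin.consEquiv, Fin.prod_univ_succ, List.ofFn_succ, mul_assoc]

theorem listExp_add (p : X → ℝ) (a b : ℕ) (f : List X → ℝ) :
    listExp p (a + b) f = listExp p a fun w => listExp p b fun y => f (w ++ y) := by
  induction a generalizing f with
  | zero => simp [listExp]
  | succ a ih =>
    rw [Nat.add_right_comm, listExp, listExp]
    simp [ih]

theorem listExp_sum {ι : Type*} (p : X → ℝ) (r : ℕ) (t : Finset ι) (f : ι → List X → ℝ) :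
    listExp p r (fun l => ∑ i ∈ t, f i l) = ∑ i ∈ t, listExp p r (f i) := by
  induction r generalizing f with
  | zero => simp [listExp]
  | succ r ih =>
    simp only [listExp, ih, Finset.mul_sum]
    rw [Finset.sum_comm]

theorem listExp_sub (p : X → ℝ) (r : ℕ) (f g : List X → ℝ) :
    listExp p r (fun l => f l - g l) = listExp p r f - listExp p r g := by
  induction r generalizing f g with
  | zero => simp [listExp]
  | succ r ih => simp only [listExp, ih, mul_sub, Finset.sum_sub_distrib]

theorem listExp_mono {p : X → ℝ} (hp : ∀ x, 0 ≤ p x) {r : ℕ} {f g : List X → ℝ}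
    (h : ∀ l, l.length = r → f l ≤ g l) : listExp p r f ≤ listExp p r g := by
  induction r generalizing f g with
  | zero => exact h [] rfl
  | succ r ih =>
    refine Finset.sum_le_sum fun x _ => mul_le_mul_of_nonneg_left (ih fun l hl => ?_) (hp x)
    exact h _ (by simp [hl])

theorem listExp_const {p : X → ℝ} (hp : ∑ x, p x = 1) (r : ℕ) (a : ℝ) :
    listExp p r (fun _ => a) = a := by
  induction r with
  | zero => simp [listExp]
  | succ r ih => simp only [listExp, ih, ← Finset.sum_mul, hp, one_mul]

theorem measurable_listExp {S : Type*} [MeasurableSpace S] (p : X → ℝ) (r : ℕ)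
    {f : List X → S → ℝ} (hf : ∀ l, Measurable (f l)) :
    Measurable fun s => listExp p r fun l => f l s := by
  induction r generalizing f with
  | zero => exact hf []
  | succ r ih =>
    simp only [listExp]
    exact Finset.measurable_sum _ fun x _ => (ih fun l => hf (x :: l)).const_mul _

theorem integral_listExp {S : Type*} [MeasurableSpace S] (μ : Measure S) (p : X → ℝ) (r : ℕ)
    {f : List X → S → ℝ} (hf : ∀ l, Integrable (f l) μ) :
    Integrable (fun s => listExp p r fun l => f l s) μ ∧
      ∫ s, listExp p r (fun l => f l s) ∂μ = listExp p r fun l => ∫ s, f l s ∂μ := by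
  induction r generalizing f with
  | zero => exact ⟨hf [], rfl⟩
  | succ r ih =>
    simp only [listExp]
    have h := fun x => ih fun l => hf (x :: l)
    refine ⟨integrable_finsetSum _ fun x _ => (h x).1.const_mul _, ?_⟩
    rw [integral_finsetSum _ fun x _ => (h x).1.const_mul _]
    refine Finset.sum_congr rfl fun x _ => ?_
    rw [integral_const_mul, (h x).2]

end ListExp

/-! ### Markov property of the run, and privacy of the state -/

namespace OnlineAlgorithm

variable {X S O : Type*} [MeasurableSpace S] [MeasurableSpace O] (M : OnlineAlgorithm X S O)

theorem runFrom_append (t : ℕ) (l l' : List X) :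
    M.runFrom t (l ++ l') = M.runFrom (t + l.length) l' ∘ₖ M.runFrom t l := by
  induction l generalizing t with
  | nil => simp [runFrom]
  | cons x l ih =>
    simp only [List.cons_append, runFrom, ih, List.length_cons, Kernel.comp_assoc]
    congr 2
    omega

theorem stateLaw_append {l : List X} (hl : l ≠ []) (l' : List X) :
    M.stateLaw (l ++ l') = (M.stateLaw l).bind (M.runFrom l.length l') := by
  cases l with
  | nil => exact absurd rfl hl
  | cons x l =>
    simp only [List.cons_append, stateLaw, runFrom_append, List.length_cons]
    rw [Measure.comp_assoc, Nat.add_comm]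

/-- The probability of an output, as an expectation over the state after a prefix of the stream. -/
theorem outputLaw_append_real {l : List X} (hl : l ≠ []) (l' : List X) {A : Set O}
    (hA : MeasurableSet A) :
    (M.outputLaw (l ++ l')).real A
      = ∫ s, ((M.out ∘ₖ M.runFrom l.length l') s).real A ∂(M.stateLaw l) := by
  rw [outputLaw, stateLaw_append M hl, Measure.comp_assoc, Measure.real,
    Measure.bind_apply hA (Kernel.aemeasurable _)]
  rw [← integral_toReal]
  · rfl
  · exact (Kernel.measurable_coe _ hA).aemeasurable
  · exact Filter.Eventually.of_forall fun s => measure_lt_top _ _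

theorem view_prod_univ {t : ℕ} {l : List X} (hl : l.take t ≠ []) {A : Set S}
    (hA : MeasurableSet A) :
    M.view t l (A ×ˢ Set.univ) = M.stateLaw (l.take t) A := by
  have := M.isProbabilityMeasure_stateLaw hl
  have h : (M.view t l).fst = M.stateLaw (l.take t) := Measure.fst_compProd _ _
  rw [← h, Measure.fst_apply hA, Set.prod_univ]

variable {M}

/-- Complete the stream arbitrarily to length `n` and test the view right after the changed element
on events `A ×ˢ Set.univ`. -/
theorem PanPrivate.stateLaw_le [DecidableEq X] {n : ℕ} {ε δ : ℝ} (h : M.PanPrivate n ε δ)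
    {w : List X} (hw : w.length < n) (x x' : X) {A : Set S} (hA : MeasurableSet A) :
    M.stateLaw (w ++ [x]) A
      ≤ ENNReal.ofReal (Real.exp ε) * M.stateLaw (w ++ [x']) A + ENNReal.ofReal δ := by
  let s : X → Fin n → X := fun y i => if hi : (i : ℕ) < w.length then w[(i : ℕ)] else y
  have hs : ∀ y, (List.ofFn (s y)).take (w.length + 1) = w ++ [y] := by
    intro y
    apply List.ext_getElem
    · simp; omega
    · intro i h1 h2
      simp only [List.getElem_take, List.getElem_ofFn, s]
      split_ifs with hi
      · rw [List.getElem_append_left hi]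
      · rw [List.getElem_append_right (by omega)]
        simp
  -- Not `s x'`, whose padding by copies of `x'` could differ from `s x` in many places.
  let y : Fin n → X := Function.update (s x) ⟨w.length, hw⟩ x'
  have hy : (List.ofFn y).take (w.length + 1) = w ++ [x'] := by
    rw [← hs x']
    apply List.ext_getElem
    · simp
    · intro i h1 h2
      simp only [List.length_take, List.length_ofFn] at h1
      simp only [List.getElem_take, List.getElem_ofFn, s, y, Function.update_apply, Fin.ext_iff]
      split_ifs <;> first | rfl | omega
  have hd : hammingDist (s x) y ≤ 1 := by
    unfold hammingDist
    rw [Finset.card_le_one]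
    have : ∀ i, s x i ≠ y i → i = ⟨w.length, hw⟩ := by
      intro i hi
      by_contra hne
      exact hi (by simp [y, Function.update_of_ne hne])
    intro a ha b hb
    rw [this a (by simpa using ha), this b (by simpa using hb)]
  have key := h (s x) y hd (w.length + 1) (by omega) (by omega) (A ×ˢ Set.univ)
    (hA.prod MeasurableSet.univ)
  rwa [view_prod_univ M (by rw [hs]; simp) hA, view_prod_univ M (by rw [hy]; simp) hA, hs, hy]
    at key

theorem outputProb_eq_listExp [Fintype X] (n : ℕ) (p : stdSimplex ℝ X) (o : O) :
    M.outputProb n p o = listExp p.1 n fun l => (M.outputLaw l).real {o} :=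
  sum_prod_ofFn_eq_listExp p.1 n fun l => (M.outputLaw l).real {o}

end OnlineAlgorithm

/-! ### Hybrid argument and sample complexity -/

section HardInstance

variable {m k n : ℕ} {S ι : Type*} [MeasurableSpace S] [MeasurableSpace ι]
  [MeasurableSingletonClass ι] {M : OnlineAlgorithm (Cube m) S ι} {P : ι → stdSimplex ℝ (Cube m)}
  {α ε δ : ℝ} {hα : α ∈ Set.Ioo (0 : ℝ) (1 / 2)} {c : Fin k → Fin m} {l : Fin k → ι}

theorem biasedDist_sub_uniformDist (j : Fin m) (x : Cube m) :
    (biasedDist m α hα j 1).1 x - (uniformDist m).1 x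
      = 2 * α * ((2 ^ m : ℝ)⁻¹ * ((x j : ℤ) : ℝ)) := by
  simp only [biasedDist, uniformDist, biasedPMF]
  rcases Int.units_eq_one_or (x j) with h | h <;> simp [h] <;> ring

/-- Replacing one biased sample by a uniform one, with the biased samples that follow it kept,
hardly changes the success probability on average over the biased coordinates. -/
theorem sum_listExp_sub_le (hε : 0 < ε) (hδ : 0 ≤ δ) (hM : M.PanPrivate n ε δ)
    (hc : Function.Injective c) (hk : 1 ≤ k) {w : List (Cube m)} {r : ℕ} (hw : w.length < n) :
    ∑ j, (listExp (biasedDist m α hα (c j) 1).1 (r + 1)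
          (fun y => (M.outputLaw (w ++ y)).real {l j})
        - ∑ x, (uniformDist m).1 x * listExp (biasedDist m α hα (c j) 1).1 r
          fun y => (M.outputLaw (w ++ x :: y)).real {l j})
      ≤ 2 * α * (8 * ε * √k + 2 * δ * k) := by
  let Q : Fin k → Cube m → ℝ := fun j => (biasedDist m α hα (c j) 1).1
  let g : Fin k → List (Cube m) → S → ℝ := fun j y s =>
    ((M.out ∘ₖ M.runFrom (w.length + 1) y) s).real {l j}
  -- The chance of output `l j` from state `s` when `r` further samples biased at `c j` follow. The
  -- future influences the bound only through this function of the state.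
  let φ : Fin k → S → ℝ := fun j s => listExp (Q j) r fun y => g j y s
  let μ : Cube m → Measure S := fun x => M.stateLaw (w ++ [x])
  have hμ : ∀ x, IsProbabilityMeasure (μ x) := fun x =>
    M.isProbabilityMeasure_stateLaw (by simp)
  have hgm : ∀ j y, Measurable (g j y) := fun j y =>
    (Kernel.measurable_coe _ (measurableSet_singleton _)).ennreal_toReal
  have hg0 : ∀ j y s, 0 ≤ g j y s := fun j y s => measureReal_nonneg
  have hg1 : ∀ j y s, g j y s ≤ 1 := fun j y s => measureReal_le_one
  have hφm : ∀ j, Measurable (φ j) := fun j => measurable_listExp _ _ (hgm j)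
  have hφa : ∀ j s, |φ j s| ≤ 1 := by
    intro j s
    have h0 : listExp (Q j) r (fun _ => 0) ≤ φ j s :=
      listExp_mono (biasedDist m α hα (c j) 1).2.1 fun y _ => hg0 j y s
    have h1 : φ j s ≤ listExp (Q j) r (fun _ => 1) :=
      listExp_mono (biasedDist m α hα (c j) 1).2.1 fun y _ => hg1 j y s
    rw [listExp_const (biasedDist m α hα (c j) 1).2.2] at h0 h1
    rw [abs_of_nonneg h0]
    exact h1
  have hout : ∀ j x, listExp (Q j) r (fun y => (M.outputLaw (w ++ x :: y)).real {l j})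
      = ∫ s, φ j s ∂(μ x) := by
    intro j x
    rw [(integral_listExp (μ x) (Q j) r fun y => integrable_of_measurable_of_abs_le (hgm j y)
      fun s => by rw [abs_of_nonneg (hg0 j y s)]; exact hg1 j y s).2]
    congr 1
    ext y
    have h := M.outputLaw_append_real (l := w ++ [x]) (by simp) y (measurableSet_singleton (l j))
    simpa [g, μ] using h
  have hφint : ∀ j x, Integrable (φ j) (μ x) := fun j x =>
    integrable_of_measurable_of_abs_le (hφm j) (hφa j)
  have key := sum_integral_signSum_le hc hk hφm hφa μ hε hδ
    fun x y A hA => hM.stateLaw_le hw x y hA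
  have heq : ∑ j, (listExp (Q j) (r + 1) (fun y => (M.outputLaw (w ++ y)).real {l j})
        - ∑ x, (uniformDist m).1 x * listExp (Q j) r
          fun y => (M.outputLaw (w ++ x :: y)).real {l j})
      = 2 * α * ((2 ^ m : ℝ)⁻¹ *
        ∑ x : Cube m, ∫ s, signSum c (fun j => φ j s) x ∂(μ x)) := by
    simp only [listExp, hout, ← Finset.sum_sub_distrib, ← sub_mul]
    rw [Finset.sum_comm, Finset.mul_sum, Finset.mul_sum]
    refine Finset.sum_congr rfl fun x _ => ?_
    simp only [signSum]
    rw [integral_finsetSum _ fun j _ => (hφint j x).const_mul _, Finset.mul_sum, Finset.mul_sum]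
    refine Finset.sum_congr rfl fun j _ => ?_
    rw [biasedDist_sub_uniformDist, integral_const_mul]
    ring
  refine heq.le.trans (mul_le_mul_of_nonneg_left key ?_)
  linarith [hα.1]

/-- Telescoping over hybrids. Uniform samples come first, so that the state law before the exchange
is the same for all `j` and `sum_listExp_sub_le` applies to each prefix. -/
theorem sum_outputProb_sub_le (hε : 0 < ε) (hδ : 0 ≤ δ) (hM : M.PanPrivate n ε δ)
    (hc : Function.Injective c) (hk : 1 ≤ k) :
    ∑ j, (M.outputProb n (biasedDist m α hα (c j) 1) (l j)
        - M.outputProb n (uniformDist m) (l j))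
      ≤ n * (2 * α * (8 * ε * √k + 2 * δ * k)) := by
  let H : ℕ → Fin k → ℝ := fun i j => listExp (uniformDist m).1 i fun w =>
    listExp (biasedDist m α hα (c j) 1).1 (n - i) fun y => (M.outputLaw (w ++ y)).real {l j}
  have hstep : ∀ i < n, ∑ j, (H i j - H (i + 1) j) ≤ 2 * α * (8 * ε * √k + 2 * δ * k) := by
    intro i hi
    obtain ⟨r, rfl⟩ : ∃ r, n = i + (r + 1) := ⟨n - i - 1, by omega⟩
    have h1 : ∑ j, (H i j - H (i + 1) j) = listExp (uniformDist m).1 i fun w =>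
        ∑ j, (listExp (biasedDist m α hα (c j) 1).1 (r + 1)
            (fun y => (M.outputLaw (w ++ y)).real {l j})
          - ∑ x, (uniformDist m).1 x * listExp (biasedDist m α hα (c j) 1).1 r
            fun y => (M.outputLaw (w ++ x :: y)).real {l j}) := by
      rw [listExp_sum]
      refine Finset.sum_congr rfl fun j _ => ?_
      rw [listExp_sub]
      simp only [H]
      rw [listExp_add _ i 1, show i + (r + 1) - i = r + 1 by omega,
        show i + (r + 1) - (i + 1) = r by omega]
      simp only [listExp, List.append_assoc, List.cons_append, List.nil_append]
    rw [h1]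
    refine (listExp_mono (uniformDist m).2.1 fun w hw =>
      sum_listExp_sub_le hε hδ hM hc hk (by omega)).trans (le_of_eq ?_)
    exact listExp_const (uniformDist m).2.2 _ _
  have h0 : ∀ j, M.outputProb n (biasedDist m α hα (c j) 1) (l j) = H 0 j := fun j => by
    simp [H, listExp, OnlineAlgorithm.outputProb_eq_listExp]
  have hn : ∀ j, M.outputProb n (uniformDist m) (l j) = H n j := fun j => by
    simp [H, listExp, OnlineAlgorithm.outputProb_eq_listExp]
  calc _ = ∑ j, (H 0 j - H n j) := by simp only [h0, hn]
    _ = ∑ i ∈ Finset.range n, ∑ j, (H i j - H (i + 1) j) := by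
        rw [Finset.sum_comm]
        refine Finset.sum_congr rfl fun j _ => ?_
        rw [Finset.sum_range_sub' fun i => H i j]
    _ ≤ ∑ _i ∈ Finset.range n, 2 * α * (8 * ε * √k + 2 * δ * k) :=
        Finset.sum_le_sum fun i hi => hstep i (Finset.mem_range.1 hi)
    _ = _ := by simp

theorem outputProb_add_sum_outputProb_le_one (hn : 1 ≤ n) (p : stdSimplex ℝ (Cube m)) {o : ι}
    (hl : Function.Injective l) (ho : o ∉ Set.range l) :
    M.outputProb n p o + ∑ j, M.outputProb n p (l j) ≤ 1 := by
  simp only [OnlineAlgorithm.outputProb_eq_listExp]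
  have hsum := Fintype.sum_option fun i : Option (Fin k) =>
    listExp p.1 n fun y => (M.outputLaw y).real {i.elim o l}
  simp only [Option.elim_none, Option.elim_some] at hsum
  rw [← hsum, ← listExp_sum]
  refine (listExp_mono p.2.1 (g := fun _ => 1) fun y hy => ?_).trans
    (listExp_const p.2.2 n 1).le
  have := M.isProbabilityMeasure_stateLaw (l := y) (by rintro rfl; simp at hy; omega)
  have hprob : IsProbabilityMeasure (M.outputLaw y) := by
    unfold OnlineAlgorithm.outputLaw; infer_instance
  have hinj : Function.Injective (fun i : Option (Fin k) => i.elim o l) := by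
    rintro (_ | i) (_ | j) hij
    · rfl
    · exact absurd ⟨j, hij.symm⟩ ho
    · exact absurd ⟨i, hij⟩ ho
    · exact congrArg some (hl hij)
  have h := measureReal_biUnion_finset (μ := M.outputLaw y) (s := Finset.univ)
    (f := fun i : Option (Fin k) => {i.elim o l})
    (fun i _ j _ hij => Set.disjoint_singleton.2 (hinj.ne hij))
    (fun i _ => measurableSet_singleton _)
  exact h.symm.le.trans measureReal_le_one

/-- Since `log (d / δ) ≥ log 2 > 1/2` for `δ > 0`, the hypothesis forces `δ ≤ ε² / d`; and `δ² ≤ δ`.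
This brings the `δk` term down to the order of `ε√k`. -/
theorem delta_le_of_mul_log_le {d : ℕ} (hd : 2 ≤ d) (hα : α ∈ Set.Ioo (0 : ℝ) (1 / 2))
    (hε : 0 < ε) (hδ : δ ∈ Set.Icc (0 : ℝ) 1)
    (h : δ * Real.log (d / δ) ≤ 1 * (α ^ 2 * ε ^ 2 / d)) : δ ≤ ε / √d := by
  have hd' : (2 : ℝ) ≤ d := by exact_mod_cast hd
  rcases hδ.1.eq_or_lt with h0 | h0
  · rw [← h0]; positivity
  have h1 : Real.log 2 ≤ Real.log (d / δ) := by
    refine Real.log_le_log (by norm_num) ?_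
    rw [le_div_iff₀ h0]
    nlinarith [hδ.2]
  have h2 : δ * (1 / 2) ≤ δ * Real.log (d / δ) := by
    gcongr
    linarith [Real.log_two_gt_d9]
  have h3 : α ^ 2 * ε ^ 2 / d ≤ (1 / 2) ^ 2 * ε ^ 2 / d := by
    gcongr
    · exact hα.1.le
    · exact hα.2.le
  refine le_of_sq_le_sq ?_ (by positivity)
  rw [div_pow, Real.sq_sqrt (by linarith)]
  calc δ ^ 2 ≤ δ := by nlinarith [hδ.2]
    _ ≤ 4 * ((1 / 2) ^ 2 * ε ^ 2 / d) := by
      have : 0 ≤ (1 / 2) ^ 2 * ε ^ 2 / d := by positivity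
      linarith
    _ = _ := by ring

/-- The lower bound, for any family of hypotheses that contains the uniform distribution and `k`
distributions biased at distinct coordinates. -/
theorem sampleComplexity_lower_bound {d : ℕ} (hd : 2 ≤ d) (hdk : d ≤ 3 * k) (hn : 1 ≤ n)
    (hε : 0 < ε) (hδ : δ ∈ Set.Icc (0 : ℝ) 1)
    (h : δ * Real.log (d / δ) ≤ 1 * (α ^ 2 * ε ^ 2 / d))
    (hM : M.PanPrivate n ε δ) (hI : M.Identifies n P)
    (hc : Function.Injective c) (hl : Function.Injective l) {o : ι} (ho : o ∉ Set.range l)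
    (hPo : P o = uniformDist m) (hPl : ∀ j, P (l j) = biasedDist m α hα (c j) 1) :
    1 / 40 * (√d / (α * ε)) ≤ n := by
  have hk : 1 ≤ k := by omega
  have hk' : (1 : ℝ) ≤ k := by exact_mod_cast hk
  have hd0 : (0 : ℝ) < d := by exact_mod_cast (by omega : 0 < d)
  have hsd : 0 < √(d : ℝ) := Real.sqrt_pos.2 hd0
  have hsk : 0 < √(k : ℝ) := Real.sqrt_pos.2 (by linarith)
  have hα0 := hα.1
  have hδ' := delta_le_of_mul_log_le hd hα hε hδ h
  have h1 := sum_outputProb_sub_le (α := α) (hα := hα) (l := l) hε hδ.1 hM hc hk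
  have h2 := outputProb_add_sum_outputProb_le_one (M := M) hn (uniformDist m) hl ho
  have h3 := hI o
  rw [hPo] at h3
  have h4 : (k : ℝ) * (99 / 100) ≤ ∑ j, M.outputProb n (biasedDist m α hα (c j) 1) (l j) := by
    calc _ = ∑ _j : Fin k, (99 / 100 : ℝ) := by simp
      _ ≤ _ := Finset.sum_le_sum fun j _ => by rw [← hPl]; exact hI (l j)
  rw [Finset.sum_sub_distrib] at h1
  have h5 : (k : ℝ) * (98 / 100) ≤ n * (2 * α * (8 * ε * √k + 2 * δ * k)) := by linarith
  -- Uses `√3 ≤ 7/4`; in this form a factor `k` cancels from both sides of `h5`.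
  have h6 : √k ≤ 7 / 4 * (k / √d) := by
    have hsd' : √(d : ℝ) ≤ 7 / 4 * √k := by
      rw [Real.sqrt_le_left (by positivity), mul_pow, Real.sq_sqrt (by linarith)]
      have : (d : ℝ) ≤ 3 * k := by exact_mod_cast hdk
      linarith
    rw [mul_div_assoc', le_div_iff₀ hsd]
    calc √k * √d ≤ √k * (7 / 4 * √k) := by gcongr
      _ = _ := by nlinarith [Real.mul_self_sqrt (by linarith : (0 : ℝ) ≤ k)]
  -- Here `32 = 2 * (8 * 7/4 + 2)`, and `0.98 / 32 ≥ 1/40` gives the final constant.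
  have h7 : (k : ℝ) * (98 / 100) ≤ k * (n * (32 * (α * ε / √d))) := by
    calc _ ≤ _ := h5
      _ ≤ n * (2 * α * (8 * ε * (7 / 4 * (k / √d)) + 2 * (ε / √d) * k)) := by gcongr
      _ = _ := by ring
  have h8 := le_of_mul_le_mul_left h7 (by linarith)
  have h9 : (n : ℝ) * (32 * (α * ε / √d)) = (n * 32) / (√d / (α * ε)) := by field_simp
  rw [h9, le_div_iff₀ (by positivity)] at h8
  have : 0 < √d / (α * ε) := by positivity
  linarith

end HardInstance

/-! ### Separation of the hard family -/

section Separation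

variable {m : ℕ} {α : ℝ} {hα : α ∈ Set.Ioo (0 : ℝ) (1 / 2)}

theorem dTV_comm {X : Type*} [Fintype X] (p q : stdSimplex ℝ X) : dTV p q = dTV q p := by
  simp only [dTV, abs_sub_comm]

/-- Any test function with values in `[-1, 1]` bounds the total variation distance from below. -/
theorem sum_mul_le_dTV {X : Type*} [Fintype X] (p q : stdSimplex ℝ X) (f : X → ℝ)
    (hf : ∀ x, |f x| ≤ 1) : 1 / 2 * ∑ x, (p.1 x - q.1 x) * f x ≤ dTV p q := by
  unfold dTV
  gcongr with x
  refine (le_abs_self _).trans ?_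
  rw [abs_mul]
  exact mul_le_of_le_one_right (abs_nonneg _) (hf x)

theorem biasedPMF_eq (j : Fin m) (b : ℤˣ) (x : Cube m) :
    biasedPMF m α j b x
      = (2 ^ m : ℝ)⁻¹ * (1 + 2 * α * (((b : ℤ) : ℝ) * ((x j : ℤ) : ℝ))) := by
  unfold biasedPMF
  rcases Int.units_eq_one_or (x j) with h | h <;> rcases Int.units_eq_one_or b with h' | h' <;>
    simp [h, h'] <;> ring

theorem units_cast_mul_self (u : ℤˣ) : ((u : ℤ) : ℝ) * ((u : ℤ) : ℝ) = 1 := by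
  rcases Int.units_eq_one_or u with h | h <;> simp [h]

theorem sum_sign_mul_sign {i j : Fin m} (hij : i ≠ j) :
    ∑ x : Cube m, ((x i : ℤ) : ℝ) * ((x j : ℤ) : ℝ) = 0 := by
  let e : Cube m ≃ Cube m :=
    Function.Involutive.toPerm (fun x => Function.update x i (-(x i))) (fun x => by simp)
  have h := Equiv.sum_comp e fun x => ((x i : ℤ) : ℝ) * ((x j : ℤ) : ℝ)
  simp [e, Function.Involutive.toPerm, Function.update_of_ne hij.symm] at h
  linarith

/-- By `biasedPMF_eq` each biased density is `2⁻ᵐ` times 1 plus `2α` times a signed character.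
Testing against the character `b * x j` of one of the two laws gives distance at least `α` by
orthogonality, and `2α` when only the signs differ. -/
theorem isSeparated_hardFamily : IsSeparated α (hardFamily m α hα) := by
  have hcard : (2 ^ m : ℝ)⁻¹ * ∑ _x : Cube m, (1 : ℝ) = 1 := by simp
  have hu : ∀ j b, α ≤ dTV (biasedDist m α hα j b) (uniformDist m) := by
    intro j b
    refine le_trans (le_of_eq ?_) (sum_mul_le_dTV _ _
      (fun x => ((b : ℤ) : ℝ) * ((x j : ℤ) : ℝ)) fun x => by simp [abs_mul, abs_units_cast])
    have : ∀ x : Cube m, ((biasedDist m α hα j b).1 x - (uniformDist m).1 x)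
        * (((b : ℤ) : ℝ) * ((x j : ℤ) : ℝ)) = 2 * α * ((2 ^ m : ℝ)⁻¹ * 1) := by
      intro x
      simp only [biasedDist, uniformDist, biasedPMF_eq]
      linear_combination (2 ^ m : ℝ)⁻¹ * 2 * α * ((x j : ℤ) : ℝ) * ((x j : ℤ) : ℝ) *
        units_cast_mul_self b + (2 ^ m : ℝ)⁻¹ * 2 * α * units_cast_mul_self (x j)
    simp_rw [this]
    rw [← Finset.mul_sum, ← Finset.mul_sum, hcard]
    ring
  have hb : ∀ j b j' b', HardLabel.biased j b ≠ HardLabel.biased j' b' →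
      α ≤ dTV (biasedDist m α hα j b) (biasedDist m α hα j' b') := by
    intro j b j' b' hne
    refine le_trans ?_ (sum_mul_le_dTV _ _
      (fun x => ((b : ℤ) : ℝ) * ((x j : ℤ) : ℝ)) fun x => by simp [abs_mul, abs_units_cast])
    have : ∀ x : Cube m, ((biasedDist m α hα j b).1 x - (biasedDist m α hα j' b').1 x)
        * (((b : ℤ) : ℝ) * ((x j : ℤ) : ℝ)) = 2 * α * ((2 ^ m : ℝ)⁻¹ * 1)
          - 2 * α * (2 ^ m : ℝ)⁻¹ * (((b : ℤ) : ℝ) * ((b' : ℤ) : ℝ)) *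
            (((x j : ℤ) : ℝ) * ((x j' : ℤ) : ℝ)) := by
      intro x
      simp only [biasedDist, biasedPMF_eq]
      linear_combination (2 ^ m : ℝ)⁻¹ * 2 * α * ((x j : ℤ) : ℝ) * ((x j : ℤ) : ℝ) *
        units_cast_mul_self b + (2 ^ m : ℝ)⁻¹ * 2 * α * units_cast_mul_self (x j)
    simp_rw [this]
    rw [Finset.sum_sub_distrib, ← Finset.mul_sum, ← Finset.mul_sum, hcard, ← Finset.mul_sum]
    by_cases hj : j = j'
    · subst hj
      have hbb : ((b : ℤ) : ℝ) * ((b' : ℤ) : ℝ) = -1 := by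
        rcases Int.units_eq_one_or b with h | h <;> rcases Int.units_eq_one_or b' with h' | h' <;>
          simp_all
      simp_rw [units_cast_mul_self]
      rw [hbb]
      linear_combination hα.1.le - α * hcard
    · rw [sum_sign_mul_sign hj]
      linarith
  rintro (_ | ⟨j, b⟩) (_ | ⟨j', b'⟩) hne
  · exact absurd rfl hne
  · rw [dTV_comm]; exact hu j' b'
  · exact hu j b
  · exact hb j b j' b' hne

theorem IsSeparated.comp {X ι κ : Type*} [Fintype X] {P : ι → stdSimplex ℝ X}
    (h : IsSeparated α P) {e : κ → ι} (he : Function.Injective e) : IsSeparated α (P ∘ e) :=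
  fun _ _ hij => h (he.ne hij)

/-- A choice of `d ≤ 2m + 1` of the labels of the hard instance: the uniform label, and the two
signs of the coordinates in turn. -/
def hardLabelOfFin {d : ℕ} (hd : d ≤ 2 * m + 1) (i : Fin d) : HardLabel m :=
  if h : (i : ℕ) = 0 then .uniform
  else .biased ⟨(i - 1) / 2, by omega⟩ (if (i : ℕ) % 2 = 1 then 1 else -1)

theorem hardLabelOfFin_injective {d : ℕ} (hd : d ≤ 2 * m + 1) :
    Function.Injective (hardLabelOfFin hd) := by
  intro i j hij
  have hne : (1 : ℤˣ) ≠ -1 := by decide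
  unfold hardLabelOfFin at hij
  ext
  split_ifs at hij <;> simp [hne, hne.symm] at hij <;> omega

end Separation

end PanPrivacy

theorem mainTheorem9 :
    ∃ c₀ > (0 : ℝ), ∃ c > (0 : ℝ),
      -- lower bound for `d`-wise simple hypothesis testing over the universe `{±1}^m`, `d ≤ 2m + 1`
      (∀ (d m n : ℕ) (α ε δ : ℝ), 2 ≤ d → d ≤ 2 * m + 1 → 1 ≤ n →
        α ∈ Set.Ioo (0 : ℝ) (1 / 2) → 0 < ε → δ ∈ Set.Icc (0 : ℝ) 1 →
        δ * Real.log (d / δ) ≤ c₀ * (α ^ 2 * ε ^ 2 / d) →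
        ∀ (S : Type*) [MeasurableSpace S]
          (M : (Fin d → stdSimplex ℝ (PanPrivacy.Cube m)) →
            PanPrivacy.OnlineAlgorithm (PanPrivacy.Cube m) S (Fin d)),
          (∀ P, PanPrivacy.IsSeparated α P → (M P).PanPrivate n ε δ) →
          PanPrivacy.SolvesHypothesisTesting d n α M →
          c * (Real.sqrt d / (α * ε)) ≤ n) ∧
      -- the hard instance: it is a legitimate set of `2m + 1` hypotheses, and it is already hard
      (∀ (m n : ℕ) (α ε δ : ℝ) (hα : α ∈ Set.Ioo (0 : ℝ) (1 / 2)), 1 ≤ m → 1 ≤ n →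
        0 < ε → δ ∈ Set.Icc (0 : ℝ) 1 →
        PanPrivacy.IsSeparated α (PanPrivacy.hardFamily m α hα) ∧
        (δ * Real.log ((2 * m + 1 : ℕ) / δ) ≤ c₀ * (α ^ 2 * ε ^ 2 / (2 * m + 1 : ℕ)) →
          ∀ (S : Type*) [MeasurableSpace S]
            (M : PanPrivacy.OnlineAlgorithm (PanPrivacy.Cube m) S (PanPrivacy.HardLabel m)),
            M.PanPrivate n ε δ →
            M.Identifies n (PanPrivacy.hardFamily m α hα) →
            c * (Real.sqrt (2 * m + 1 : ℕ) / (α * ε)) ≤ n)) := by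
  refine ⟨1, one_pos, 1 / 40, by norm_num, ?_, ?_⟩
  · intro d m n α ε δ hd hdm hn hα hε hδ h S _ M hM hI
    let e := PanPrivacy.hardLabelOfFin hdm
    let P := PanPrivacy.hardFamily m α hα ∘ e
    have hP : PanPrivacy.IsSeparated α P :=
      PanPrivacy.isSeparated_hardFamily.comp (PanPrivacy.hardLabelOfFin_injective hdm)
    -- The odd label `2j + 1` stands for sign `+1` at coordinate `j`, and `d / 2` such labels lie
    -- below `d`. The bound `d ≤ 3 * (d / 2)` is tight at `d = 3`.
    refine PanPrivacy.sampleComplexity_lower_bound (k := d / 2) (M := M P) (P := P) (hα := hα)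
      (c := fun j => ⟨j, by omega⟩) (l := fun j => ⟨2 * j + 1, by omega⟩) (o := ⟨0, by omega⟩)
      hd (by omega) hn hε hδ h (hM P hP) (hI P hP) ?_ ?_ ?_ ?_ ?_
    · intro i j hij
      simpa [Fin.ext_iff] using hij
    · intro i j hij
      simpa [Fin.ext_iff] using hij
    · simp
    · simp [P, e, PanPrivacy.hardLabelOfFin, PanPrivacy.hardFamily]
    · intro j
      simp [P, e, PanPrivacy.hardLabelOfFin, PanPrivacy.hardFamily]
  · intro m n α ε δ hα hm hn hε hδ
    refine ⟨PanPrivacy.isSeparated_hardFamily, fun h S _ M hM hI => ?_⟩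
    refine PanPrivacy.sampleComplexity_lower_bound (k := m) (hα := hα) (c := id)
      (l := fun j => .biased j 1) (o := .uniform) (by omega) (by omega) hn hε hδ h hM hI
      Function.injective_id ?_ ?_ rfl fun j => rfl
    · intro i j hij
      simpa using hij
    · simp
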